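/- All graphs are finite, simple and undirected. For a graph $G$ let $N(v)$ be the set of neighbours of a vertex $v$ and $\Delta(G)$ the maximum degree. A tree decomposition of $G$ is a tree $T$ with a bag $B_t\subseteq V(G)$ for each $t\in V(T)$, such that every vertex of $G$ lies in some bag, both ends of every edge of $G$ lie in a common bag, and for each vertex $x$ of $G$ the set $\{t : x\in B_t\}$ induces a connected subtree of $T$. Its width is $\max_t |B_t|-1$, and the treewidth $\mathrm{w}(G)$ is the minimum width of a tree decomposition of $G$. Splitting a vertex $v$ of $G$ with support $S\subseteq N(v)$ means adding a new vertex $v'$ adjacent to $v$ and, for each $s\in S$, replacing the edge $vs$ by the edge $v's$. A graph $G'$ is an expansion of $G$ if it is obtained from $G$ (up to isomorphism) by a finite sequence of splittings; it is a ternary expansion if moreover $\Delta(G')\le 3$. Let $\bar K_{n,n}$ be the bipartite graph with vertices $v_i, v'_i$ ($i\in\mathbb{Z}_n$) in which $v_i$ and $v'_j$ are adjacent if and only if $i\ne j$ (that is, $K_{n,n}$ minus a perfect matching). **Proposition.** Let $n\ge 19$. Then $\mathrm{w}(\bar K_{n,n})=n-1$, and every ternary expansion $G_n$ of $\bar K_{n,n}$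 satisfies $\mathrm{w}(G_n)\ge n$. Hence every ternary expansion of $\bar K_{n,n}$ has treewidth at least $\mathrm{w}(\bar K_{n,n})+1$. -/

import Mathlib

universe u v w

namespace SimpleGraph

/-- A tree decomposition of `G` whose tree has vertex type `ι`. The bags are the sets `bag t`. -/
structure TreeDecomposition {V : Type u} (G : SimpleGraph V) (ι : Type v) where
  tree : SimpleGraph ι
  isTree : tree.IsTree
  bag : ι → Set V
  exists_mem_bag : ∀ x : V, ∃ t, x ∈ bag t
  exists_edge_subset_bag : ∀ x y : V, G.Adj x y → ∃ t, x ∈ bag t ∧ y ∈ bag t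
  connected_bags : ∀ x : V, (tree.induce {t | x ∈ bag t}).Connected

/-- The width of a tree decomposition: the largest size of a bag, minus one.
(The subtraction truncates only if all bags are empty, that is, if `G` has no vertex.) -/
noncomputable def TreeDecomposition.width {V : Type u} {G : SimpleGraph V} {ι : Type v}
    (D : TreeDecomposition G ι) : ℕ∞ :=
  (⨆ t, (D.bag t).encard) - 1

/-- The treewidth of `G`: the least width of a tree decomposition of `G` over a finite tree. -/
noncomputable def treewidth {V : Type u} (G : SimpleGraph V) : ℕ∞ :=
  sInf {k | ∃ (ι : Type) (_ : Finite ι) (D : TreeDecomposition G ι), D.width = k}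

/-- The splitting of the vertex `a` of `G` with support `S` (used for `S ⊆ N(a)`): a new vertex
`none` is connected to `a`, and each `s ∈ S` is disconnected from `a` and connected to `none`. -/
def splitting {V : Type u} (G : SimpleGraph V) (a : V) (S : Set V) : SimpleGraph (Option V) where
  Adj
    | none, none => False
    | none, some y => y = a ∨ y ∈ S
    | some x, none => x = a ∨ x ∈ S
    | some x, some y => G.Adj x y ∧ ¬ (x = a ∧ y ∈ S) ∧ ¬ (y = a ∧ x ∈ S)
  symm := ⟨by
    rintro (_ | x) (_ | y) h
    · exact h
    · exact h
    · exact h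
    · exact ⟨h.1.symm, h.2.2, h.2.1⟩⟩
  loopless := ⟨by
    rintro (_ | x) h
    · exact h
    · exact G.loopless.irrefl x h.1⟩

/-- `IsExpansion G G'`: a finite (possibly empty) sequence of splittings transforms `G` into `G'`.
Graphs are considered up to isomorphism. -/
inductive IsExpansion {V : Type u} (G : SimpleGraph V) :
    ∀ {W : Type w}, SimpleGraph W → Prop
  | of_iso {W : Type w} (H : SimpleGraph W) (e : Nonempty (G ≃g H)) : IsExpansion G H
  | split {W W' : Type w} (H : SimpleGraph W) (H' : SimpleGraph W') (hH : IsExpansion G H)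
      (a : W) (S : Set W) (hS : S ⊆ H.neighborSet a)
      (e : Nonempty (H.splitting a S ≃g H')) : IsExpansion G H'

/-- `G'` is a ternary expansion of `G`: an expansion of maximum degree at most `3`. -/
def IsTernaryExpansion {V : Type u} (G : SimpleGraph V) {W : Type w} (G' : SimpleGraph W)
    [Fintype W] [DecidableRel G'.Adj] : Prop :=
  G.IsExpansion G' ∧ G'.maxDegree ≤ 3

/-- The complete bipartite graph on two copies of `ℤ/n` with the perfect matching
joining the two copies of each `i` removed. -/
def bipartiteMinusMatching (n : ℕ) : SimpleGraph (ZMod n ⊕ ZMod n) :=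
  (completeBipartiteGraph (ZMod n) (ZMod n)).deleteEdges
    (Set.range fun i : ZMod n => s(Sum.inl i, Sum.inr i))

end SimpleGraph

namespace SimpleGraph

/-! An expansion has the original graph as a minor; beyond that, only the degree bound matters.
Suppose that all bags have at most `n` vertices. Each bag `X` then misses two branch sets that are
joined off `X`. This is clear if two adjacent vertices have branch sets missing `X`. Otherwise `X`
meets each branch set of one part exactly once, and a vertex of `X`, having at most 3 neighbours,
reaches two of the `n - 1 ≥ 4` adjacent branch sets through the same neighbour
(`IsMinorModel.exists_reachable_of_degree_lt`).

Let each node point towards a vertex chosen from those two branch sets. Two adjacent nodes point at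
each other (`IsTree.exists_mutual`), so the intersection of their bags separates their chosen
vertices. But it has fewer than `n` vertices, and removing so few from the bipartite graph cuts off
at most one of the others, so each joined pair is attached to the main component: a contradiction
(`IsMinorModel.le_treewidth`).

For the bipartite graph itself the same argument with `n - 1` gives the lower bound, and a star
decomposition the upper one. -/

/-- The graph on the same vertex type in which all vertices of `X` are isolated. -/
def isolateVertices {V : Type u} (G : SimpleGraph V) (X : Set V) : SimpleGraph V where
  Adj x y := G.Adj x y ∧ x ∉ X ∧ y ∉ X
  symm := ⟨fun _ _ h => ⟨h.1.symm, h.2.2, h.2.1⟩⟩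
  loopless := ⟨fun _ h => G.loopless.irrefl _ h.1⟩

/-! ### Reachability after removing vertices. -/

section Reachability

variable {V : Type u} {W : Type w} {G : SimpleGraph V} {H : SimpleGraph W}

theorem isolateVertices_anti {X Y : Set V} (h : X ⊆ Y) :
    G.isolateVertices Y ≤ G.isolateVertices X :=
  fun _ _ hab => ⟨hab.1, fun hX => hab.2.1 (h hX), fun hX => hab.2.2 (h hX)⟩

theorem Reachable.of_invariant {x y : V} (h : G.Reachable x y) (p : V → Prop)
    (step : ∀ a b, G.Adj a b → p a → p b) (hx : p x) : p y := by
  obtain ⟨q⟩ := h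
  induction q with
  | nil => exact hx
  | cons hab _ ih => exact ih (step _ _ hab hx)

theorem Reachable.map_of_adj {x y : V} (h : G.Reachable x y) (φ : V → W)
    (step : ∀ a b, G.Adj a b → H.Reachable (φ a) (φ b)) : H.Reachable (φ x) (φ y) :=
  h.of_invariant (fun z => H.Reachable (φ x) (φ z)) (fun a b hab ha => ha.trans (step a b hab))
    (Reachable.refl _)

theorem Walk.reachable_isolateVertices {X : Set V} {x y : V} (p : G.Walk x y)
    (hp : ∀ z ∈ p.support, z ∉ X) : (G.isolateVertices X).Reachable x y := by
  induction p with
  | nil => exact Reachable.refl _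
  | cons hab q ih =>
    rw [Walk.support_cons] at hp
    have hq := fun z hz => hp z (List.mem_cons_of_mem _ hz)
    exact (Adj.reachable (G := G.isolateVertices X)
      ⟨hab, hp _ List.mem_cons_self, hq _ q.start_mem_support⟩).trans (ih hq)

/-- A vertex reaching a different one does so through a neighbour that avoids it. -/
theorem Reachable.exists_adj_reachable_isolateVertices {x y : V} (h : G.Reachable x y)
    (hne : x ≠ y) : ∃ m, G.Adj x m ∧ (G.isolateVertices {x}).Reachable m y := by
  obtain ⟨p, hp⟩ := h.exists_isPath
  cases p with
  | nil => exact absurd rfl hne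
  | cons hab q =>
    rw [Walk.cons_isPath_iff] at hp
    refine ⟨_, hab, q.reachable_isolateVertices fun z hz hzx => hp.2 ?_⟩
    rw [Set.mem_singleton_iff] at hzx
    exact hzx ▸ hz

end Reachability

/-! ### Finite trees, subtrees and separation by bags. -/

section Tree

variable {ι : Type v} {T : SimpleGraph ι}

theorem isolateVertices_singleton_le_deleteEdges (t s : ι) :
    T.isolateVertices {t} ≤ T.deleteEdges {s(t, s)} := by
  intro a b hab
  rw [deleteEdges_adj]
  refine ⟨hab.1, fun h => ?_⟩
  rw [Set.mem_singleton_iff, Sym2.eq_iff] at h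
  rcases h with h | h
  · exact hab.2.1 h.1
  · exact hab.2.2 h.2

/-- A subtree avoiding the node `t` lies beyond one edge at `t`. -/
theorem IsTree.exists_adj_forall_reachable (hT : T.IsTree) {N : Set ι}
    (hN : (T.induce N).Connected) {t : ι} (ht : t ∉ N) :
    ∃ s, T.Adj t s ∧ ∀ r ∈ N, (T.deleteEdges {s(t, s)}).Reachable s r := by
  obtain ⟨⟨r₀, hr₀⟩⟩ := hN.nonempty
  obtain ⟨s, hts, hs⟩ := (hT.connected.preconnected t r₀).exists_adj_reachable_isolateVertices
    (fun h => ht (h ▸ hr₀))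
  refine ⟨s, hts, fun r hr => (hs.trans ?_).mono (isolateVertices_singleton_le_deleteEdges t s)⟩
  refine (hN.preconnected ⟨r₀, hr₀⟩ ⟨r, hr⟩).map_of_adj Subtype.val fun a b hab => ?_
  exact Adj.reachable ⟨hab, fun h => ht (h ▸ a.2), fun h => ht (h ▸ b.2)⟩

/-- If every node of a finite tree points to a neighbour, then two adjacent nodes
point to each other. -/
theorem IsTree.exists_mutual [Finite ι] (hT : T.IsTree) (g : ι → ι) (hg : ∀ t, T.Adj t (g t)) :
    ∃ t, g (g t) = t := by
  have := hT.connected.nonempty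
  let side (t : ι) : Set ι := {r | (T.deleteEdges {s(t, g t)}).Reachable (g t) r}
  -- Take the smallest side pointed to. If `g t` did not point back, its side would lie strictly
  -- inside, since it omits `g t`.
  obtain ⟨t, ht⟩ := Finite.exists_min fun t => (side t).ncard
  refine ⟨t, by_contra fun hne => (ht (g t)).not_gt (Set.ncard_lt_ncard ?_ (Set.toFinite _))⟩
  have hbr : ¬ (T.deleteEdges {s(g t, g (g t))}).Reachable (g t) (g (g t)) :=
    isAcyclic_iff_forall_adj_isBridge.1 hT.isAcyclic (hg (g t))
  have hsub : side (g t) ⊆ side t := by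
    intro r hr
    refine (Reachable.of_invariant hr (fun r =>
      (T.deleteEdges {s(g t, g (g t))}).Reachable (g (g t)) r ∧
        (T.deleteEdges {s(t, g t)}).Reachable (g t) r) ?_ ⟨Reachable.refl _, ?_⟩).2
    · rintro a b hab ⟨h₁, h₂⟩
      have h₃ := h₁.trans hab.reachable
      refine ⟨h₃, h₂.trans (Adj.reachable ?_)⟩
      rw [deleteEdges_adj] at hab ⊢
      refine ⟨hab.1, fun h => hbr ?_⟩
      rw [Set.mem_singleton_iff, Sym2.eq_iff] at h
      rcases h with ⟨-, h⟩ | ⟨h, -⟩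
      · exact (h ▸ h₃).symm
      · exact (h ▸ h₁).symm
    · refine Adj.reachable ?_
      rw [deleteEdges_adj]
      refine ⟨hg (g t), fun h => ?_⟩
      rw [Set.mem_singleton_iff, Sym2.eq_iff] at h
      rcases h with ⟨h, -⟩ | ⟨-, h⟩
      · exact (hg t).ne h.symm
      · exact hne h
  exact (Set.ssubset_iff_of_subset hsub).2 ⟨g t, Reachable.refl _, fun h => hbr h.symm⟩

/-- A path inside `N` from `x` to `y` has to cross the deleted edge. -/
theorem IsTree.mem_of_induce_connected_of_reachable {N : Set ι}
    (hN : (T.induce N).Connected) {t s x y : ι} (hx : x ∈ N) (hy : y ∈ N)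
    (hsx : (T.deleteEdges {s(t, s)}).Reachable s x)
    (hsy : ¬ (T.deleteEdges {s(t, s)}).Reachable s y) : t ∈ N ∧ s ∈ N := by
  by_contra hts
  refine hsy (hsx.trans ?_)
  refine (hN.preconnected ⟨x, hx⟩ ⟨y, hy⟩).map_of_adj Subtype.val fun a b hab => ?_
  refine Adj.reachable ?_
  rw [deleteEdges_adj]
  refine ⟨hab, fun h => hts ?_⟩
  rw [Set.mem_singleton_iff, Sym2.eq_iff] at h
  rcases h with ⟨h₁, h₂⟩ | ⟨h₁, h₂⟩
  · exact ⟨h₁ ▸ a.2, h₂ ▸ b.2⟩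
  · exact ⟨h₂ ▸ b.2, h₁ ▸ a.2⟩

end Tree

/-- Choosing a vertex outside of each bag, one finds two bags such that the intersection of
the bags separates the vertices chosen for them. -/
theorem TreeDecomposition.exists_not_reachable {W : Type w} {G : SimpleGraph W} {ι : Type v}
    [Finite ι] (D : TreeDecomposition G ι) (c : Set W → W) (hc : ∀ t, c (D.bag t) ∉ D.bag t) :
    ∃ s t, ¬ (G.isolateVertices (D.bag s ∩ D.bag t)).Reachable (c (D.bag s)) (c (D.bag t)) := by
  choose g hadj hg using fun t => D.isTree.exists_adj_forall_reachable
    (D.connected_bags (c (D.bag t))) (hc t)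
  obtain ⟨t, ht⟩ := D.isTree.exists_mutual g hadj
  have hbr : ¬ (D.tree.deleteEdges {s(t, g t)}).Reachable t (g t) :=
    isAcyclic_iff_forall_adj_isBridge.1 D.isTree.isAcyclic (hadj t)
  refine ⟨t, g t, fun hreach => ?_⟩
  -- Along a path off both bags no subtree crosses the edge from `t` to `g t`, so all of them stay
  -- on the side of `g t`.
  have key : ∀ r, c (D.bag (g t)) ∈ D.bag r →
      (D.tree.deleteEdges {s(t, g t)}).Reachable (g t) r := by
    refine hreach.of_invariant (fun x => ∀ r, x ∈ D.bag r →
      (D.tree.deleteEdges {s(t, g t)}).Reachable (g t) r) ?_ (hg t)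
    intro a b hab ha r hr
    by_contra hnr
    obtain ⟨q, hqa, hqb⟩ := D.exists_edge_subset_bag a b hab.1
    exact hab.2.2 (IsTree.mem_of_induce_connected_of_reachable (D.connected_bags b)
      hqb hr (ha q hqa) hnr)
  obtain ⟨r, hr⟩ := D.exists_mem_bag (c (D.bag (g t)))
  -- Since `g t` points back to `t`, the same subtree also lies on the side of `t`.
  have h₂ := hg (g t) r hr
  rw [ht, Sym2.eq_swap] at h₂
  exact hbr (h₂.trans (key r hr).symm)

/-! ### Minor models and expansions. -/

/-- `f` exhibits `K` as a minor of `G`: its fibres are nonempty connected branch sets,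
and adjacent vertices of `K` have adjacent branch sets. -/
structure IsMinorModel {V : Type u} {W : Type w} (K : SimpleGraph V) (G : SimpleGraph W)
    (f : W → V) : Prop where
  surjective : Function.Surjective f
  reachable : ∀ x y, f x = f y → (G.isolateVertices {z | f z ≠ f x}).Reachable x y
  exists_adj : ∀ u v, K.Adj u v → ∃ x y, f x = u ∧ f y = v ∧ G.Adj x y

namespace IsMinorModel

variable {V : Type u} {W : Type w} {K : SimpleGraph V} {G : SimpleGraph W} {f : W → V}

protected theorem id (K : SimpleGraph V) : IsMinorModel K K id where
  surjective := Function.surjective_id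
  reachable _ y h := by cases h; exact Reachable.refl _
  exists_adj u v h := ⟨u, v, rfl, rfl, h⟩

theorem comp_iso {W' : Type*} {G' : SimpleGraph W'} (h : IsMinorModel K G f) (e : G ≃g G') :
    IsMinorModel K G' (f ∘ e.symm) where
  surjective := h.surjective.comp e.symm.surjective
  reachable x y hxy := by
    have := (h.reachable _ _ hxy).map_of_adj (H := G'.isolateVertices
      {z | (f ∘ e.symm) z ≠ (f ∘ e.symm) x}) e fun a b hab => by
        refine Adj.reachable ⟨e.map_adj_iff.2 hab.1, ?_, ?_⟩
        · simpa using hab.2.1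
        · simpa using hab.2.2
    simpa using this
  exists_adj u v huv := by
    obtain ⟨x, y, hx, hy, hxy⟩ := h.exists_adj u v huv
    exact ⟨e x, e y, by simpa using hx, by simpa using hy, e.map_adj_iff.2 hxy⟩

/-- The new vertex joins the branch set of `a`, so an edge moved away from `a` is replaced by a
detour through `none`. -/
theorem splitting (h : IsMinorModel K G f) (a : W) (S : Set W) :
    IsMinorModel K (G.splitting a S) (fun x => f (x.getD a)) where
  surjective u := by
    obtain ⟨x, rfl⟩ := h.surjective u
    exact ⟨some x, rfl⟩
  reachable := by
    have hnone : ∀ {u}, f a = u → ((G.splitting a S).isolateVertices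
        {z | f (z.getD a) ≠ u}).Reachable none (some a) := fun {u} hu =>
      Adj.reachable ⟨Or.inl rfl, fun hz => hz hu, fun hz => hz hu⟩
    have hsome : ∀ x y, f x = f y → ((G.splitting a S).isolateVertices
        {z | f (z.getD a) ≠ f x}).Reachable (some x) (some y) := by
      intro x y hxy
      refine (h.reachable x y hxy).map_of_adj some ?_
      rintro b c ⟨hbc, hb, hc⟩
      have hb' : some b ∉ {z | f (Option.getD z a) ≠ f x} := hb
      have hc' : some c ∉ {z | f (Option.getD z a) ≠ f x} := hc
      by_cases h₁ : b = a ∧ c ∈ S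
      · obtain ⟨rfl, hcS⟩ := h₁
        have hba := hnone (not_not.1 hb)
        exact hba.symm.trans (Adj.reachable ⟨Or.inr hcS, hb', hc'⟩)
      by_cases h₂ : c = a ∧ b ∈ S
      · obtain ⟨rfl, hbS⟩ := h₂
        have hca := hnone (not_not.1 hc)
        have hbn : ((G.splitting c S).isolateVertices
            {z | f (Option.getD z c) ≠ f x}).Adj (some b) none := ⟨Or.inr hbS, hb', hc'⟩
        exact hbn.reachable.trans hca
      exact Adj.reachable ⟨⟨hbc, h₁, h₂⟩, hb', hc'⟩
    rintro (_ | x) (_ | y) hxy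
    · exact Reachable.refl _
    · exact (hnone rfl).trans (hsome a y hxy)
    · exact (hsome x a hxy).trans (hnone hxy.symm).symm
    · exact hsome x y hxy
  exists_adj u v huv := by
    obtain ⟨x, y, hx, hy, hxy⟩ := h.exists_adj u v huv
    by_cases h₁ : x = a ∧ y ∈ S
    · exact ⟨none, some y, h₁.1 ▸ hx, hy, Or.inr h₁.2⟩
    by_cases h₂ : y = a ∧ x ∈ S
    · exact ⟨some x, none, hx, h₂.1 ▸ hy, Or.inr h₂.2⟩
    exact ⟨some x, some y, hx, hy, hxy, h₁, h₂⟩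

theorem reachable_of_fiber (h : IsMinorModel K G f) {X : Set W} {x y : W} (hxy : f x = f y)
    (hx : f x ∉ f '' X) : (G.isolateVertices X).Reachable x y :=
  (h.reachable x y hxy).mono (isolateVertices_anti fun z hz hzx => hx ⟨z, hz, hzx⟩)

/-- Paths of `K` avoiding the image of `X` lift to paths of `G` avoiding `X`. -/
theorem reachable_of_reachable (h : IsMinorModel K G f) {X : Set W} {x y : W}
    (hx : f x ∉ f '' X) (hxy : (K.isolateVertices (f '' X)).Reachable (f x) (f y)) :
    (G.isolateVertices X).Reachable x y := by
  have := hxy.of_invariant (fun u => u ∉ f '' X ∧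
    ∀ y, f y = u → (G.isolateVertices X).Reachable x y) ?_
      ⟨hx, fun y hy => h.reachable_of_fiber hy.symm hx⟩
  · exact this.2 y rfl
  · rintro u v ⟨huv, hu, hv⟩ ⟨-, hxu⟩
    refine ⟨hv, fun y hy => ?_⟩
    obtain ⟨a, b, rfl, rfl, hab⟩ := h.exists_adj _ _ huv
    refine (hxu a rfl).trans (Reachable.trans (Adj.reachable
      ⟨hab, fun ha => hu ⟨a, ha, rfl⟩, fun hb => hv ⟨b, hb, rfl⟩⟩)
        (h.reachable_of_fiber hy.symm hv))

/-- Suppose that the branch set of `f x` meets `X` in `x` alone, that `x` has fewer neighbours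
than `s` has elements, and that `X` avoids the branch sets of the elements of `s`, all adjacent
to `f x`. Then `G - X` connects two of these branch sets. -/
theorem exists_reachable_of_degree_lt (h : IsMinorModel K G f) {X : Set W} {x : W}
    (hX : ∀ z ∈ X, f z = f x → z = x) (hfin : (G.neighborSet x).Finite) {s : Finset V}
    (hs : ∀ v ∈ s, K.Adj (f x) v ∧ v ∉ f '' X) (hcard : (G.neighborSet x).ncard < s.card) :
    ∃ y z, f y ∈ s ∧ f z ∈ s ∧ f y ≠ f z ∧ (G.isolateVertices X).Reachable y z := by
  have key : ∀ v ∈ s, ∃ m z, G.Adj x m ∧ f z = v ∧ (G.isolateVertices X).Reachable m z := by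
    intro v hv
    obtain ⟨hadj, hvX⟩ := hs v hv
    obtain ⟨y, z, hy, rfl, hyz⟩ := h.exists_adj _ _ hadj
    by_cases hyx : y = x
    · exact ⟨z, z, hyx ▸ hyz, rfl, Reachable.refl _⟩
    obtain ⟨m, hxm, hmy⟩ := (h.reachable x y hy.symm).exists_adj_reachable_isolateVertices
      (Ne.symm hyx)
    refine ⟨m, z, hxm.1, rfl, (hmy.mono ?_).trans (Adj.reachable
      ⟨hyz, fun hyX => hyx (hX y hyX hy), fun hzX => hvX ⟨z, hzX, rfl⟩⟩)⟩
    rintro a b ⟨⟨hab, ha, hb⟩, hax, hbx⟩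
    exact ⟨hab, fun haX => hax (hX a haX (not_not.1 ha)),
      fun hbX => hbx (hX b hbX (not_not.1 hb))⟩
  have : Nonempty W := ⟨x⟩
  choose! m z hm hz hmz using key
  -- Pigeonhole: two elements of `s` are reached through the same neighbour of `x`.
  obtain ⟨u, hu, v, hv, huv, hmuv⟩ := Finset.exists_ne_map_eq_of_card_lt_of_maps_to
    (t := hfin.toFinset) (by rwa [← Set.ncard_eq_toFinset_card _ hfin])
    (fun v hv => by simpa using hm v hv : ∀ v ∈ s, m v ∈ hfin.toFinset)
  refine ⟨z u, z v, (hz u hu).symm ▸ hu, (hz v hv).symm ▸ hv, ?_,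
    (hmz u hu).symm.trans (hmuv ▸ hmz v hv)⟩
  rwa [hz u hu, hz v hv]

end IsMinorModel

theorem IsExpansion.exists_isMinorModel {V : Type u} {W : Type w} {K : SimpleGraph V}
    {G : SimpleGraph W} (h : K.IsExpansion G) : ∃ f : W → V, IsMinorModel K G f := by
  induction h with
  | of_iso H e =>
    obtain ⟨e⟩ := e
    exact ⟨_, (IsMinorModel.id K).comp_iso e⟩
  | split H H' _ a S _ e ih =>
    obtain ⟨e⟩ := e
    obtain ⟨f, hf⟩ := ih
    exact ⟨_, (hf.splitting a S).comp_iso e⟩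

/-! ### The lower bound for treewidth. -/

theorem TreeDecomposition.encard_bag_le_of_width_lt {V : Type u} {G : SimpleGraph V}
    {ι : Type v} (D : TreeDecomposition G ι) {m : ℕ} (h : D.width < m) (t : ι) :
    (D.bag t).encard ≤ m := by
  refine (le_iSup (fun t => (D.bag t).encard) t).trans ?_
  rw [TreeDecomposition.width] at h
  have h₁ := Order.add_one_le_of_lt h
  exact le_tsub_add.trans h₁

/-- If each set of at most `m` vertices of `G` leaves two branch sets that can be connected outside
of it, whereas sets of fewer than `m` vertices of `K` cannot separate two pairs
of distinct vertices, then `G` has treewidth at least `m`. -/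
theorem IsMinorModel.le_treewidth {V : Type u} {W : Type w} [Finite W] {K : SimpleGraph V}
    {G : SimpleGraph W} {f : W → V} (h : IsMinorModel K G f) {m : ℕ}
    (hpair : ∀ X : Set W, X.ncard ≤ m → ∃ x y, f x ∉ f '' X ∧ f y ∉ f '' X ∧ f x ≠ f y ∧
      (G.isolateVertices X).Reachable x y)
    (hsep : ∀ Z : Set V, Z.Finite → Z.ncard < m → ∃ p q, p ∉ Z ∧ ∀ v, v ∉ Z → v ≠ q →
      (K.isolateVertices Z).Reachable p v) : (m : ℕ∞) ≤ G.treewidth := by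
  refine le_sInf ?_
  rintro k ⟨ι, hι, D, rfl⟩
  by_contra! hlt
  have hcard : ∀ t, (D.bag t).ncard ≤ m := fun t => by
    have := D.encard_bag_le_of_width_lt hlt t
    rwa [← (Set.toFinite (D.bag t)).cast_ncard_eq, Nat.cast_le] at this
  have hW : Nonempty W := by
    obtain ⟨t⟩ := D.isTree.connected.nonempty
    obtain ⟨x, -⟩ := hpair _ (hcard t)
    exact ⟨x⟩
  choose! c d hc hd hne hcd using hpair
  obtain ⟨s, t, hst⟩ := D.exists_not_reachable c
    fun t ht => hc _ (hcard t) ⟨_, ht, rfl⟩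
  set Y := D.bag s ∩ D.bag t
  -- The choice `c` depends on the bag and not on the node, so equal bags would give the same
  -- vertex.
  have hbag : ¬ D.bag s ⊆ D.bag t ∨ ¬ D.bag t ⊆ D.bag s := by
    by_contra! hsub
    rw [subset_antisymm hsub.1 hsub.2] at hst
    exact hst (Reachable.refl _)
  have hY : Y.ncard < m := by
    rcases hbag with hb | hb
    · exact (Set.ncard_lt_ncard (Set.inter_ssubset_left_iff.2 hb)).trans_le (hcard s)
    · exact (Set.ncard_lt_ncard (Set.inter_ssubset_right_iff.2 hb)).trans_le (hcard t)
  obtain ⟨p, q, hp, hpq⟩ := hsep (f '' Y) (Set.toFinite _) ((Set.ncard_image_le).trans_lt hY)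
  obtain ⟨p, rfl⟩ := h.surjective p
  have hkey : ∀ r, Y ⊆ D.bag r → (G.isolateVertices Y).Reachable p (c (D.bag r)) := by
    intro r hr
    have himg := Set.image_mono (f := f) hr
    -- If `c` falls into the one exceptional branch set, `d` does not, and it is joined to `c`.
    by_cases hq : f (c (D.bag r)) = q
    · refine (h.reachable_of_reachable hp (hpq (f (d (D.bag r)))
        (fun hm => hd _ (hcard r) (himg hm)) fun hq' => ?_)).trans
          ((hcd _ (hcard r)).mono (isolateVertices_anti hr)).symm
      exact hne _ (hcard r) (hq.trans hq'.symm)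
    · exact h.reachable_of_reachable hp (hpq _ (fun hm => hc _ (hcard r) (himg hm)) hq)
  exact hst ((hkey s Set.inter_subset_left).symm.trans (hkey t Set.inter_subset_right))

/-! ### The complete bipartite graph minus a perfect matching. -/

/-- The vertex with index `i` in the part of `bipartiteMinusMatching n` that `b` selects. -/
def partVertex {n : ℕ} (b : Bool) (i : ZMod n) : ZMod n ⊕ ZMod n :=
  if b then Sum.inl i else Sum.inr i

section BipartiteMinusMatching

variable {n : ℕ}

theorem bipartiteMinusMatching_adj_partVertex {b c : Bool} {i j : ZMod n} :
    (bipartiteMinusMatching n).Adj (partVertex b i) (partVertex c j) ↔ b ≠ c ∧ i ≠ j := by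
  cases b <;> cases c <;> simp [bipartiteMinusMatching, partVertex, @eq_comm _ j i]

theorem exists_eq_partVertex (v : ZMod n ⊕ ZMod n) : ∃ b i, v = partVertex b i := by
  rcases v with i | i
  · exact ⟨true, i, rfl⟩
  · exact ⟨false, i, rfl⟩

theorem partVertex_injective2 : Function.Injective2 (partVertex (n := n)) := by
  intro b c i j h
  cases b <;> cases c <;> simp_all [partVertex]

theorem ncard_preimage_partVertex_add [NeZero n] (Z : Set (ZMod n ⊕ ZMod n)) (b : Bool) :
    (partVertex b ⁻¹' Z).ncard + (partVertex (!b) ⁻¹' Z).ncard = Z.ncard := by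
  have hZ : Z = partVertex b '' (partVertex b ⁻¹' Z) ∪
      partVertex (!b) '' (partVertex (!b) ⁻¹' Z) := by
    ext v
    obtain ⟨c, i, rfl⟩ := exists_eq_partVertex v
    rcases eq_or_ne c b with rfl | hc
    · simp [partVertex_injective2.eq_iff]
    · obtain rfl : c = !b := by cases b <;> cases c <;> simp_all
      simp [partVertex_injective2.eq_iff]
  conv_rhs => rw [hZ]
  rw [Set.ncard_union_eq ?_ (Set.toFinite _) (Set.toFinite _),
    Set.ncard_image_of_injective _ (partVertex_injective2.right b),
    Set.ncard_image_of_injective _ (partVertex_injective2.right (!b))]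
  rw [Set.disjoint_left]
  rintro _ ⟨i, -, rfl⟩ ⟨j, -, h⟩
  exact absurd (partVertex_injective2 h).1 (by cases b <;> simp)

theorem ncard_compl_zmod [NeZero n] (A : Set (ZMod n)) : A.ncard + Aᶜ.ncard = n := by
  rw [Set.ncard_add_ncard_compl A, Nat.card_zmod]

/-- If at least three vertices of one part and at least one of the other avoid `Z`, then all
vertices off `Z`, except possibly one, are connected to each other off `Z`. -/
theorem exists_forall_reachable_of_three_le [NeZero n] {Z : Set (ZMod n ⊕ ZMod n)} {b : Bool}
    (h₁ : 3 ≤ (partVertex b ⁻¹' Z)ᶜ.ncard) (h₂ : 1 ≤ (partVertex (!b) ⁻¹' Z)ᶜ.ncard) :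
    ∃ p q, p ∉ Z ∧ ∀ v, v ∉ Z → v ≠ q →
      ((bipartiteMinusMatching n).isolateVertices Z).Reachable p v := by
  obtain ⟨a, ha⟩ := Set.nonempty_of_ncard_ne_zero (Nat.one_le_iff_ne_zero.1 h₂)
  have hadj : ∀ {i j : ZMod n}, i ≠ j → partVertex b i ∉ Z → partVertex (!b) j ∉ Z →
      ((bipartiteMinusMatching n).isolateVertices Z).Adj
        (partVertex (!b) j) (partVertex b i) := fun hij hi hj =>
    ⟨bipartiteMinusMatching_adj_partVertex.2 ⟨by simp, hij.symm⟩, hj, hi⟩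
  refine ⟨partVertex (!b) a, partVertex b a, ha, fun v hv hva => ?_⟩
  obtain ⟨c, i, rfl⟩ := exists_eq_partVertex v
  rcases eq_or_ne c b with rfl | hc
  · exact (hadj (fun h => hva (congrArg _ h)) hv ha).reachable
  · obtain rfl : c = !b := by cases b <;> cases c <;> simp_all
    -- Among three vertices one has an index other than `a` and `i`, hence is a common neighbour.
    obtain ⟨k, hk, hkai⟩ := Set.exists_mem_notMem_of_ncard_lt_ncard
      (s := {a, i}) (t := (partVertex b ⁻¹' Z)ᶜ)
      ((Set.ncard_insert_le a {i}).trans_lt (by rw [Set.ncard_singleton]; exact h₁))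
    simp only [Set.mem_insert_iff, Set.mem_singleton_iff, not_or] at hkai
    exact (hadj hkai.1 hk ha).reachable.trans (hadj hkai.2 hk hv).symm.reachable

/-- At least `n + 1` vertices survive: both parts keep one, and some part keeps three. -/
theorem exists_forall_reachable_of_ncard_lt (hn : 5 ≤ n) {Z : Set (ZMod n ⊕ ZMod n)}
    (hZ : Z.ncard < n) : ∃ p q, p ∉ Z ∧ ∀ v, v ∉ Z → v ≠ q →
      ((bipartiteMinusMatching n).isolateVertices Z).Reachable p v := by
  have : NeZero n := ⟨by lia⟩
  have h₀ := ncard_preimage_partVertex_add Z true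
  have h₁ := ncard_compl_zmod (partVertex true ⁻¹' Z)
  have h₂ := ncard_compl_zmod (partVertex (!true) ⁻¹' Z)
  by_cases h : 3 ≤ (partVertex true ⁻¹' Z)ᶜ.ncard
  · exact exists_forall_reachable_of_three_le h (by lia)
  · exact exists_forall_reachable_of_three_le (b := !true) (by lia) (by rw [Bool.not_not]; lia)

/-- Among the vertices outside a set of at most `n` vertices there are two adjacent ones, unless
the set is one of the two parts. -/
theorem exists_adj_or_eq_range_partVertex (hn : 3 ≤ n) {Z : Set (ZMod n ⊕ ZMod n)}
    (hZ : Z.ncard ≤ n) :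
    (∃ u v, u ∉ Z ∧ v ∉ Z ∧ (bipartiteMinusMatching n).Adj u v) ∨
      ∃ b, Z = Set.range (partVertex b) := by
  have : NeZero n := ⟨by lia⟩
  refine or_iff_not_imp_left.2 fun hno => ?_
  have hno' : ∀ i j, partVertex true i ∉ Z → partVertex (!true) j ∉ Z → i = j :=
    fun i j hi hj => by_contra fun hij => hno ⟨_, _, hi, hj,
      bipartiteMinusMatching_adj_partVertex.2 ⟨by simp, hij⟩⟩
  have h₀ := ncard_preimage_partVertex_add Z true
  have h₁ := ncard_compl_zmod (partVertex true ⁻¹' Z)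
  have h₂ := ncard_compl_zmod (partVertex (!true) ⁻¹' Z)
  -- If both parts had survivors, all would share one index, leaving at most two; but at least `n ≥
  -- 3` survive.
  have hone : (partVertex true ⁻¹' Z)ᶜ = ∅ ∨ (partVertex (!true) ⁻¹' Z)ᶜ = ∅ := by
    by_contra! hne
    obtain ⟨⟨i, hi⟩, ⟨j, hj⟩⟩ := hne
    have h₃ : (partVertex true ⁻¹' Z)ᶜ.ncard ≤ 1 :=
      (Set.ncard_le_one_iff (Set.toFinite _)).2 fun ha hb => (hno' _ j ha hj).trans (hno' _ j hb hj).symm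
    have h₄ : (partVertex (!true) ⁻¹' Z)ᶜ.ncard ≤ 1 :=
      (Set.ncard_le_one_iff (Set.toFinite _)).2 fun ha hb => (hno' i _ hi ha).symm.trans (hno' i _ hi hb)
    lia
  have key : ∀ b, (partVertex b ⁻¹' Z)ᶜ = ∅ → Z = Set.range (partVertex b) := by
    intro b hb
    rw [Set.compl_empty_iff] at hb
    refine (Set.eq_of_subset_of_ncard_le ?_ ?_ (Set.toFinite _)).symm
    · rintro _ ⟨i, rfl⟩
      exact Set.mem_preimage.1 (hb ▸ Set.mem_univ i)
    · rwa [← Set.image_univ, Set.ncard_image_of_injective _ (partVertex_injective2.right b),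
        Set.ncard_univ, Nat.card_zmod]
  rcases hone with h | h
  · exact ⟨true, key _ h⟩
  · exact ⟨!true, key _ h⟩

/-- The tree decomposition over a star whose central bag is one part and whose other bags are the
closed neighbourhoods of the vertices of the other part. -/
noncomputable def bipartiteMinusMatchingDecomposition (n : ℕ) :
    TreeDecomposition (bipartiteMinusMatching n) (Option (ZMod n)) where
  tree := starGraph none
  isTree := isTree_starGraph none
  bag
    | none => Set.range Sum.inl
    | some j => insert (Sum.inr j) (Sum.inl '' {j}ᶜ)
  exists_mem_bag
    | .inl i => ⟨none, i, rfl⟩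
    | .inr j => ⟨some j, Or.inl rfl⟩
  exists_edge_subset_bag := by
    have key : ∀ i j, (bipartiteMinusMatching n).Adj (Sum.inl i) (Sum.inr j) → i ≠ j :=
      fun i j h => ((bipartiteMinusMatching_adj_partVertex (b := true) (c := false)).1 h).2
    rintro (i | i) (j | j) h
    · exact absurd rfl
        ((bipartiteMinusMatching_adj_partVertex (b := true) (c := true)).1 h).1
    · exact ⟨some j, Or.inr ⟨i, key i j h, rfl⟩, Or.inl rfl⟩
    · exact ⟨some i, Or.inl rfl, Or.inr ⟨j, key j i h.symm, rfl⟩⟩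
    · exact absurd rfl
        ((bipartiteMinusMatching_adj_partVertex (b := false) (c := false)).1 h).1
  connected_bags := by
    rintro (i | j)
    · rw [connected_iff_exists_forall_reachable]
      refine ⟨⟨none, i, rfl⟩, ?_⟩
      rintro ⟨_ | j, hj⟩
      · exact Reachable.refl _
      · exact Adj.reachable (starGraph_adj.2 ⟨by simp, Or.inl rfl⟩)
    · rw [connected_iff_exists_forall_reachable]
      refine ⟨⟨some j, Or.inl rfl⟩, ?_⟩
      rintro ⟨_ | k, hk⟩
      · simp at hk
      · obtain rfl : j = k := by simpa using hk
        exact Reachable.refl _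

theorem treewidth_bipartiteMinusMatching_le [NeZero n] :
    (bipartiteMinusMatching n).treewidth ≤ ((n - 1 : ℕ) : ℕ∞) := by
  have hmem : (bipartiteMinusMatching n).treewidth ≤
      (bipartiteMinusMatchingDecomposition n).width :=
    sInf_le ⟨_, inferInstance, bipartiteMinusMatchingDecomposition n, rfl⟩
  refine hmem.trans ?_
  rw [TreeDecomposition.width, ENat.natCast_sub, Nat.cast_one]
  refine tsub_le_tsub_right (iSup_le fun t => ?_) 1
  rw [← Set.Finite.cast_ncard_eq (Set.toFinite _), Nat.cast_le]
  rcases t with _ | j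
  · change (Set.range (Sum.inl : ZMod n → ZMod n ⊕ ZMod n)).ncard ≤ n
    rw [← Set.image_univ, Set.ncard_image_of_injective _ Sum.inl_injective, Set.ncard_univ,
      Nat.card_zmod]
  · change (insert (Sum.inr j) (Sum.inl '' {j}ᶜ) : Set (ZMod n ⊕ ZMod n)).ncard ≤ n
    refine (Set.ncard_insert_le _ _).trans ?_
    rw [Set.ncard_image_of_injective _ Sum.inl_injective, add_comm]
    simpa using (ncard_compl_zmod {j}).le

/-- A set of at most `n - 1` vertices is too small to be a part, so it always misses two adjacent
vertices. -/
theorem le_treewidth_bipartiteMinusMatching (hn : 5 ≤ n) :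
    ((n - 1 : ℕ) : ℕ∞) ≤ (bipartiteMinusMatching n).treewidth := by
  have : NeZero n := ⟨by lia⟩
  refine (IsMinorModel.id _).le_treewidth (fun X hX => ?_)
    fun Z _ hZ => exists_forall_reachable_of_ncard_lt hn (by lia)
  rw [Set.image_id]
  rcases exists_adj_or_eq_range_partVertex (by lia) (hX.trans (Nat.sub_le n 1)) with
    ⟨u, v, hu, hv, huv⟩ | ⟨b, rfl⟩
  · exact ⟨u, v, hu, hv, huv.ne, Adj.reachable ⟨huv, hu, hv⟩⟩
  · rw [← Set.image_univ, Set.ncard_image_of_injective _ (partVertex_injective2.right b),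
      Set.ncard_univ, Nat.card_zmod] at hX
    lia

/-- A graph of maximum degree at most `3` with `bipartiteMinusMatching n` as a minor has treewidth
at least `n`. -/
theorem IsMinorModel.le_treewidth_of_maxDegree_le_three (hn : 5 ≤ n) {W : Type w} [Fintype W]
    {G : SimpleGraph W} [DecidableRel G.Adj] {f : W → ZMod n ⊕ ZMod n}
    (h : IsMinorModel (bipartiteMinusMatching n) G f) (hG : G.maxDegree ≤ 3) :
    (n : ℕ∞) ≤ G.treewidth := by
  have : NeZero n := ⟨by lia⟩
  refine h.le_treewidth (fun X hX => ?_)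
    fun Z _ hZ => exists_forall_reachable_of_ncard_lt hn hZ
  have himg : (f '' X).ncard ≤ X.ncard := Set.ncard_image_le
  rcases exists_adj_or_eq_range_partVertex (by lia) (himg.trans hX) with
    ⟨u, v, hu, hv, huv⟩ | ⟨b, hb⟩
  · obtain ⟨x, rfl⟩ := h.surjective u
    obtain ⟨y, rfl⟩ := h.surjective v
    exact ⟨x, y, hu, hv, huv.ne, h.reachable_of_reachable hu (Adj.reachable ⟨huv, hu, hv⟩)⟩
  -- `X` has at most `n` vertices and its image has `n`, so no branch set meets `X` twice.
  have hinj : Set.InjOn f X := by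
    refine Set.injOn_of_ncard_image_eq (le_antisymm himg (hX.trans ?_))
    rw [hb, ← Set.image_univ, Set.ncard_image_of_injective _ (partVertex_injective2.right b),
      Set.ncard_univ, Nat.card_zmod]
  obtain ⟨x, hxX, hx⟩ : partVertex b 0 ∈ f '' X := hb ▸ ⟨0, rfl⟩
  have hnot : ∀ i, partVertex (!b) i ∉ f '' X := by
    rw [hb]
    rintro i ⟨j, hj⟩
    exact absurd (partVertex_injective2 hj).1 (by cases b <;> simp)
  have hdeg : (G.neighborSet x).ncard ≤ 3 := by
    rw [Set.ncard_eq_toFinset_card']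
    exact (G.degree_le_maxDegree x).trans hG
  -- The neighbours of `partVertex b 0` are the `n - 1` vertices of the other part with nonzero
  -- index; `5 ≤ n` makes them more than 3.
  obtain ⟨y, z, hy, hz, hyz, hr⟩ := h.exists_reachable_of_degree_lt
    (s := (Finset.univ.erase (0 : ZMod n)).map ⟨_, partVertex_injective2.right (!b)⟩)
    (fun z hz hzx => hinj hz hxX hzx) (Set.toFinite _) (by
      simp only [Finset.mem_map, Finset.mem_erase]
      rintro _ ⟨i, ⟨hi, -⟩, rfl⟩
      exact ⟨hx ▸ bipartiteMinusMatching_adj_partVertex.2 ⟨by simp, hi.symm⟩, hnot i⟩)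
    (by
      rw [Finset.card_map, Finset.card_erase_of_mem (Finset.mem_univ _), Finset.card_univ,
        ZMod.card]
      lia)
  obtain ⟨i, -, hi⟩ := Finset.mem_map.1 hy
  obtain ⟨j, -, hj⟩ := Finset.mem_map.1 hz
  exact ⟨y, z, hi ▸ hnot i, hj ▸ hnot j, hyz, hr⟩

end BipartiteMinusMatching

end SimpleGraph

theorem mainTheorem2 (n : ℕ) (hn : 19 ≤ n) :
    (SimpleGraph.bipartiteMinusMatching n).treewidth = ((n - 1 : ℕ) : ℕ∞) ∧
      ∀ {W : Type w} [Fintype W] (G' : SimpleGraph W) [DecidableRel G'.Adj],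
        (SimpleGraph.bipartiteMinusMatching n).IsTernaryExpansion G' →
          (n : ℕ∞) ≤ G'.treewidth := by
  have : NeZero n := ⟨by lia⟩
  refine ⟨le_antisymm SimpleGraph.treewidth_bipartiteMinusMatching_le
    (SimpleGraph.le_treewidth_bipartiteMinusMatching (by lia)), fun G' _ hG' => ?_⟩
  obtain ⟨f, hf⟩ := hG'.1.exists_isMinorModel
  exact hf.le_treewidth_of_maxDegree_le_three (by lia) hG'.2
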